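/- Let $V$ be a real vector space of finite dimension $n+1$ ($n\ge 0$), let $\mathbb P=\mathbb P(V)$ be the associated $n$-dimensional real projective space with its usual (quotient) topology, $\pi\colon V\setminus\{0\}\to\mathbb P$ the projection, and $\mathbb P^{*}=\mathbb P(V^{*})$ the dual projective space. In a real projective space, the two line segments joining distinct points $p=\pi(u)$ and $q=\pi(v)$ are $\{\pi(\lambda u+\mu v): \lambda\mu\ge 0,\ (\lambda,\mu)\ne(0,0)\}$ and $\{\pi(\lambda u+\mu v): \lambda\mu\le 0,\ (\lambda,\mu)\ne(0,0)\}$. A subset $S$ is *convex* if any two distinct points of $S$ are joined by a line segment contained in $S$ and some projective hyperplane is disjoint from $S$. A subset is *multi-convex* if it is the intersection of a nonempty family of convex sets. A convex set $A$ is *irreducible* if $A=B\cap C$ with $B,C$ convex implies $A=B$ or $A=C$. A point $p=\pi(v)\in\mathbb P$ and a point $q\in\mathbb P^{*}$ represented by $f\in V^*\setminus\{0\}$ are incident if $f(v)=0$. Put $\delta(q)=\{p\in\mathbb P: p,q \text{ not incident}\}$ for $q\in\mathbb P^*$ and $\delta(p)=\{q\in\mathbb P^*: p,q\text{ not incident}\}$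 for $p\in\mathbb P$; these are the complements of the hyperplanes corresponding to $q$ and $p$. For $S\subseteq\mathbb P$ define $$\Phi(S)=\{q\in\mathbb P^{*} : \delta(q)\text{ is an irreducible convex set in }\mathbb P\text{ containing }S\},$$ and for $T\subseteq\mathbb P^{*}$ define, in the same way, $$\Phi(T)=\{p\in\mathbb P : \delta(p)\text{ is an irreducible convex set in }\mathbb P^{*}\text{ containing }T\}.$$ Then each of the functions $\Phi\colon 2^{\mathbb P}\to 2^{\mathbb P^{*}}$ and $\Phi\colon 2^{\mathbb P^{*}}\to 2^{\mathbb P}$ sends every nonempty open multi-convex set to a closed multi-convex set, and every nonempty closed multi-convex set to an open multi-convex set. -/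

import Mathlib

open scoped LinearAlgebra.Projectivization

namespace ProjConvex

section General

variable {V : Type*} [AddCommGroup V] [Module ℝ V]

/-- The standard topology on a real projective space: the quotient topology along
`π : V \ {0} → ℙ ℝ V`, where `V` has its module topology, which for finite-dimensional `V` is the
usual (unique Hausdorff vector space) topology. -/
noncomputable instance instTopologicalSpace : TopologicalSpace (ℙ ℝ V) :=
  TopologicalSpace.coinduced (fun v : {v : V // v ≠ 0} => Projectivization.mk ℝ v.1 v.2)
    (TopologicalSpace.induced (fun v : {v : V // v ≠ 0} => v.1) (moduleTopology ℝ V))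

/-- `{ π(λu + μv) | λμ ≥ 0, not both of λ, μ zero }`.
(The proof `h` is needed only to form the point; for linearly independent `u`, `v` it always
exists.) -/
def segmentPos (u v : V) : Set (ℙ ℝ V) :=
  {x | ∃ a b : ℝ, 0 ≤ a * b ∧ (a ≠ 0 ∨ b ≠ 0) ∧
    ∃ h : a • u + b • v ≠ 0, x = Projectivization.mk ℝ (a • u + b • v) h}

/-- `{ π(λu + μv) | λμ ≤ 0, not both of λ, μ zero }`. -/
def segmentNeg (u v : V) : Set (ℙ ℝ V) :=
  {x | ∃ a b : ℝ, a * b ≤ 0 ∧ (a ≠ 0 ∨ b ≠ 0) ∧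
    ∃ h : a • u + b • v ≠ 0, x = Projectivization.mk ℝ (a • u + b • v) h}

/-- `L` is one of the two projective line segments joining the distinct points `p`, `q`. -/
def IsLineSegment (p q : ℙ ℝ V) (L : Set (ℙ ℝ V)) : Prop :=
  p ≠ q ∧ ∃ (u v : V) (hu : u ≠ 0) (hv : v ≠ 0),
    Projectivization.mk ℝ u hu = p ∧ Projectivization.mk ℝ v hv = q ∧
      (L = segmentPos u v ∨ L = segmentNeg u v)

/-- Any two (distinct) points of `S` can be joined by a line segment contained in `S`. -/
def IsSemiconvex (S : Set (ℙ ℝ V)) : Prop :=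
  ∀ p ∈ S, ∀ q ∈ S, p ≠ q → ∃ L, IsLineSegment p q L ∧ L ⊆ S

/-- Projective hyperplanes: projectivizations of linear subspaces of codimension one. -/
def IsHyperplane (H : Set (ℙ ℝ V)) : Prop :=
  ∃ W : Submodule ℝ V, Module.finrank ℝ W + 1 = Module.finrank ℝ V ∧
    H = {p : ℙ ℝ V | p.submodule ≤ W}

/-- Projective convex sets: semiconvex sets avoided by some projective hyperplane. -/
def IsConvex (S : Set (ℙ ℝ V)) : Prop :=
  IsSemiconvex S ∧ ∃ H, IsHyperplane H ∧ Disjoint H S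

/-- Multi-convex sets: intersections of nonempty families of projective convex sets. -/
def IsMultiConvex (S : Set (ℙ ℝ V)) : Prop :=
  ∃ F : Set (Set (ℙ ℝ V)), F.Nonempty ∧ (∀ C ∈ F, IsConvex C) ∧ S = ⋂₀ F

/-- Irreducible convex sets. -/
def IsIrreducibleConvex (A : Set (ℙ ℝ V)) : Prop :=
  IsConvex A ∧ ∀ B C : Set (ℙ ℝ V), IsConvex B → IsConvex C → A = B ∩ C → A = B ∨ A = C

end General

section Duality

variable {V : Type*} [AddCommGroup V] [Module ℝ V]

/-- The point `p` of `ℙ` and the point `q` of the dual projective space are incident: `p` lies in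
the hyperplane of `ℙ` corresponding to `q` (equivalently, `q` lies in the hyperplane of the dual
space corresponding to `p`). -/
def Incident (p : ℙ ℝ V) (q : ℙ ℝ (Module.Dual ℝ V)) : Prop :=
  ∀ v ∈ p.submodule, ∀ f ∈ q.submodule, f v = 0

/-- `δ(q)` for a point `q` of the dual space: the complement in `ℙ` of the hyperplane
corresponding to `q`. For a set `C` in `ℙ`, `δ(C) = q` means `C = δ(q)`. -/
def deltaOfDual (q : ℙ ℝ (Module.Dual ℝ V)) : Set (ℙ ℝ V) :=
  {p | ¬ Incident p q}

/-- `δ(p)` for a point `p` of `ℙ`: the complement in the dual space of the hyperplane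
corresponding to `p`. For a set `C` in the dual space, `δ(C) = p` means `C = δ(p)`. -/
def delta (p : ℙ ℝ V) : Set (ℙ ℝ (Module.Dual ℝ V)) :=
  {q | ¬ Incident p q}

/-- `Φ : 2^ℙ → 2^ℙ*`, `Φ(S) = {δ(C) | C an irreducible convex set in ℙ containing S}`. -/
def Phi (S : Set (ℙ ℝ V)) : Set (ℙ ℝ (Module.Dual ℝ V)) :=
  {q | ∃ C : Set (ℙ ℝ V), IsIrreducibleConvex C ∧ S ⊆ C ∧ C = deltaOfDual q}

/-- `Φ : 2^ℙ* → 2^ℙ`, `Φ(T) = {δ(C) | C an irreducible convex set in ℙ* containing T}`. -/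
def PhiDual (T : Set (ℙ ℝ (Module.Dual ℝ V))) : Set (ℙ ℝ V) :=
  {p | ∃ C : Set (ℙ ℝ (Module.Dual ℝ V)), IsIrreducibleConvex C ∧ T ⊆ C ∧ C = delta p}

end Duality

end ProjConvex

namespace ProjConvex

/-! ### Hyperplane complements as convex sets. -/

section Convexity

variable {W : Type*} [AddCommGroup W] [Module ℝ W]

/-! A hyperplane complement is a maximal convex set, hence irreducible. So irreducibility in `Phi`
is automatic, and `Phi S` consists of the hyperplanes missing `S`: it is the complement of
`meeting`, the set of hyperplanes that hit `S`. Equivalently it is the intersection of the sets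
`delta p` for `p ∈ S`, which gives multi-convexity.

The topology then reduces to two facts about incidence: `meeting` preserves openness (an incident
point can be moved along with its hyperplane, `isOpen_meeting`) and closedness (projective space is
compact, `isClosed_meeting`). Both are proved for a general bilinear pairing, so one argument serves
both directions of the duality. -/

/-- The complement of the projective hyperplane `φ = 0`. -/
def nonvanishing (φ : W →ₗ[ℝ] ℝ) : Set (ℙ ℝ W) :=
  {q | ¬ q.submodule ≤ LinearMap.ker φ}

theorem mk_mem_nonvanishing {φ : W →ₗ[ℝ] ℝ} {w : W} {hw : w ≠ 0} :
    Projectivization.mk ℝ w hw ∈ nonvanishing φ ↔ φ w ≠ 0 := by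
  simp [nonvanishing, Projectivization.submodule_mk, Submodule.span_singleton_le_iff_mem]

theorem isSemiconvex_nonvanishing (φ : W →ₗ[ℝ] ℝ) : IsSemiconvex (nonvanishing φ) := by
  intro p hp q hq hpq
  induction p using Projectivization.ind with | h u hu =>
  induction q using Projectivization.ind with | h v hv =>
  rw [mk_mem_nonvanishing] at hp hq
  -- The sign condition keeps `a * φ u` and `b * φ v` from having opposite signs, so their sum
  -- vanishes only if both do. The sign of `φ u * φ v` thus selects the segment.
  have key (a b : ℝ) (hab : 0 ≤ (a * b) * (φ u * φ v)) (h0 : a ≠ 0 ∨ b ≠ 0) :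
      φ (a • u + b • v) ≠ 0 := by
    intro h
    simp only [map_add, map_smul, smul_eq_mul] at h
    have hb : (b * φ v) ^ 2 ≤ 0 := by
      have : (a * b) * (φ u * φ v) = -(b * φ v) ^ 2 := by linear_combination (b * φ v) * h
      linarith
    have hb0 : b = 0 := by simpa [hq] using sq_nonpos_iff _ |>.1 hb
    have ha0 : a = 0 := by simpa [hb0, hp] using h
    tauto
  rcases le_total 0 (φ u * φ v) with h | h
  · refine ⟨segmentPos u v, ⟨hpq, u, v, hu, hv, rfl, rfl, Or.inl rfl⟩, ?_⟩
    rintro _ ⟨a, b, hab, h0, _, rfl⟩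
    exact mk_mem_nonvanishing.2 (key a b (mul_nonneg hab h) h0)
  · refine ⟨segmentNeg u v, ⟨hpq, u, v, hu, hv, rfl, rfl, Or.inr rfl⟩, ?_⟩
    rintro _ ⟨a, b, hab, h0, _, rfl⟩
    exact mk_mem_nonvanishing.2 (key a b (mul_nonneg_of_nonpos_of_nonpos hab h) h0)

variable [FiniteDimensional ℝ W]

theorem isConvex_nonvanishing {φ : W →ₗ[ℝ] ℝ} (hφ : φ ≠ 0) : IsConvex (nonvanishing φ) :=
  ⟨isSemiconvex_nonvanishing φ, _,
    ⟨LinearMap.ker φ, Module.Dual.finrank_ker_add_one_of_ne_zero hφ, rfl⟩,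
    Set.disjoint_left.2 fun _ hp hn => hn hp⟩

/-- A hyperplane avoided by `B` lies inside `φ = 0`, and equal dimensions force the two to coincide.
-/
theorem IsConvex.eq_nonvanishing_of_subset {φ : W →ₗ[ℝ] ℝ} (hφ : φ ≠ 0) {B : Set (ℙ ℝ W)}
    (hB : IsConvex B) (h : nonvanishing φ ⊆ B) : nonvanishing φ = B := by
  obtain ⟨-, _, ⟨U, hU, rfl⟩, hdisj⟩ := hB
  have hle : U ≤ LinearMap.ker φ := by
    intro w hw
    by_contra hφw
    have hw0 : w ≠ 0 := by rintro rfl; simp at hφw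
    refine Set.disjoint_left.1 hdisj ?_ (h (mk_mem_nonvanishing (hw := hw0).2 hφw))
    simpa [Projectivization.submodule_mk, Submodule.span_singleton_le_iff_mem] using hw
  have hUker : U = LinearMap.ker φ := Submodule.eq_of_le_of_finrank_eq hle (by
    have := Module.Dual.finrank_ker_add_one_of_ne_zero hφ
    omega)
  refine h.antisymm fun q hq hle' => Set.disjoint_left.1 hdisj ?_ hq
  exact hUker ▸ hle'

theorem isIrreducibleConvex_nonvanishing {φ : W →ₗ[ℝ] ℝ} (hφ : φ ≠ 0) :
    IsIrreducibleConvex (nonvanishing φ) :=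
  ⟨isConvex_nonvanishing hφ, fun _ _ hB _ h =>
    Or.inl (hB.eq_nonvanishing_of_subset hφ (h ▸ Set.inter_subset_left))⟩

end Convexity

/-! ### Topology of incidence for a bilinear pairing. -/

section Pairing

variable {V W : Type*} [AddCommGroup V] [Module ℝ V] [AddCommGroup W] [Module ℝ W]

/-- The cone over a set of points of a projective space, without the origin. -/
def cone (S : Set (ℙ ℝ V)) : Set V :=
  {v | ∃ h : v ≠ 0, Projectivization.mk ℝ v h ∈ S}

theorem smul_mem_cone {S : Set (ℙ ℝ V)} {v : V} (hv : v ∈ cone S) {a : ℝ} (ha : a ≠ 0) :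
    a • v ∈ cone S := by
  obtain ⟨h, hS⟩ := hv
  refine ⟨smul_ne_zero ha h, ?_⟩
  rwa [(Projectivization.mk_eq_mk_iff' ℝ (a • v) v (smul_ne_zero ha h) h).2 ⟨a, rfl⟩]

/-- The points orthogonal to some point of `S` with respect to the pairing `B`. -/
def meeting (B : V →ₗ[ℝ] W →ₗ[ℝ] ℝ) (S : Set (ℙ ℝ V)) : Set (ℙ ℝ W) :=
  {q | ∃ p ∈ S, B p.rep q.rep = 0}

theorem mem_cone_meeting {B : V →ₗ[ℝ] W →ₗ[ℝ] ℝ} {S : Set (ℙ ℝ V)} {f : W} :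
    f ∈ cone (meeting B S) ↔ f ≠ 0 ∧ ∃ v ∈ cone S, B v f = 0 := by
  have hrep {v : V} {f : W} (hv : v ≠ 0) (hf : f ≠ 0) :
      B (Projectivization.mk ℝ v hv).rep (Projectivization.mk ℝ f hf).rep = 0 ↔ B v f = 0 := by
    obtain ⟨a, ha⟩ := Projectivization.exists_smul_eq_mk_rep ℝ v hv
    obtain ⟨b, hb⟩ := Projectivization.exists_smul_eq_mk_rep ℝ f hf
    simp [← ha, ← hb, Units.smul_def]
  constructor
  · rintro ⟨hf, p, hp, h⟩
    induction p using Projectivization.ind with | h v hv =>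
    exact ⟨hf, v, ⟨hv, hp⟩, (hrep hv hf).1 h⟩
  · rintro ⟨hf, v, ⟨hv, hp⟩, h⟩
    exact ⟨hf, _, hp, (hrep hv hf).2 h⟩

theorem isMultiConvex_compl_meeting [FiniteDimensional ℝ W] {B : V →ₗ[ℝ] W →ₗ[ℝ] ℝ} (hB : B.SeparatingLeft)
    {S : Set (ℙ ℝ V)} (hS : S.Nonempty) : IsMultiConvex (meeting B S)ᶜ := by
  refine ⟨(fun p : ℙ ℝ V => nonvanishing (B p.rep)) '' S, hS.image _, ?_, ?_⟩
  · rintro _ ⟨p, -, rfl⟩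
    exact isConvex_nonvanishing fun h => p.rep_nonzero (hB _ fun f => by simp [h])
  · ext q
    simp [meeting, nonvanishing, Projectivization.submodule_eq,
      Submodule.span_singleton_le_iff_mem]

variable [FiniteDimensional ℝ V] [TopologicalSpace V] [IsModuleTopology ℝ V]

variable (V) in
theorem t2Space : T2Space V :=
  have := IsModuleTopology.toContinuousAdd ℝ V
  let e := (Module.finBasis ℝ V).equivFun
  T2Space.of_injective_continuous e.injective
    (IsModuleTopology.continuous_of_linearMap e.toLinearMap)

/-- Since `V \ {0}` is open in `V`, the quotient topology can be tested on cones in `V` itself. -/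
theorem isOpen_iff_isOpen_cone {S : Set (ℙ ℝ V)} : IsOpen S ↔ IsOpen (cone S) := by
  have hemb : Topology.IsOpenEmbedding (fun v : {v : V // v ≠ 0} => v.1) :=
    have := t2Space V
    isOpen_ne.isOpenEmbedding_subtypeVal
  have himg : cone S = (fun v : {v : V // v ≠ 0} => v.1) ''
      ((fun v : {v : V // v ≠ 0} => Projectivization.mk ℝ v.1 v.2) ⁻¹' S) := by
    ext v
    simp [cone]
  rw [himg, ← hemb.isOpen_iff_image_isOpen]
  have htop := eq_moduleTopology ℝ V
  subst htop
  exact Iff.rfl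

variable (V) in
/-- Every line of a finite-dimensional space meets a fixed compact set away from the origin. -/
theorem exists_isCompact_forall_exists_smul_mem :
    ∃ K : Set V, IsCompact K ∧ (0 : V) ∉ K ∧ ∀ v : V, v ≠ 0 → ∃ a : ℝ, a ≠ 0 ∧ a • v ∈ K := by
  have : IsTopologicalAddGroup V := IsModuleTopology.topologicalAddGroup ℝ V
  let e : V ≃ₗ[ℝ] EuclideanSpace ℝ (Fin (Module.finrank ℝ V)) :=
    LinearEquiv.ofFinrankEq _ _ (by simp)
  refine ⟨e.symm '' Metric.sphere 0 1, (isCompact_sphere 0 1).image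
    (LinearMap.continuous_of_finiteDimensional e.symm.toLinearMap), ?_, fun v hv => ?_⟩
  · rintro ⟨x, hx, hx0⟩
    rw [e.symm.map_eq_zero_iff.1 hx0] at hx
    simp at hx
  · have hev : ‖e v‖ ≠ 0 := by simpa using hv
    refine ⟨‖e v‖⁻¹, inv_ne_zero hev, e (‖e v‖⁻¹ • v), ?_, e.symm_apply_apply _⟩
    simp [norm_smul, hev]

variable [FiniteDimensional ℝ W] [TopologicalSpace W] [IsModuleTopology ℝ W]

theorem isOpen_meeting {B : V →ₗ[ℝ] W →ₗ[ℝ] ℝ} (hB : B.SeparatingRight) {S : Set (ℙ ℝ V)}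
    (hS : IsOpen S) : IsOpen (meeting B S) := by
  have := IsModuleTopology.toContinuousAdd ℝ V
  have := IsModuleTopology.toContinuousAdd ℝ W
  have := t2Space W
  have : IsTopologicalAddGroup V := IsModuleTopology.topologicalAddGroup ℝ V
  rw [isOpen_iff_isOpen_cone] at hS ⊢
  rw [isOpen_iff_mem_nhds]
  intro f₀ hf₀
  obtain ⟨hf₀, v₀, hv₀, h₀⟩ := mem_cone_meeting.1 hf₀
  obtain ⟨w, hw⟩ : ∃ w, B w f₀ ≠ 0 := by
    by_contra! h
    exact hf₀ (hB f₀ h)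
  have hcont (v : V) : Continuous (B v) := IsModuleTopology.continuous_of_linearMap (B v)
  -- Correcting `v₀` along `w` makes it orthogonal to `f`; the correction is zero at `f₀`, so the
  -- corrected vector stays in the open cone for `f` near `f₀`.
  have hc : ContinuousAt (fun f => v₀ - (B v₀ f / B w f) • w) f₀ :=
    continuousAt_const.sub
      (((hcont v₀).continuousAt.div (hcont w).continuousAt hw).smul continuousAt_const)
  have h1 : ∀ᶠ f in nhds f₀, v₀ - (B v₀ f / B w f) • w ∈ cone S :=
    hc.eventually_mem (hS.mem_nhds (by simpa [h₀] using hv₀))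
  filter_upwards [h1, (hcont w).continuousAt.eventually_ne hw, eventually_ne_nhds hf₀]
    with f hf hwf hf0
  exact mem_cone_meeting.2 ⟨hf0, _, hf, by simp [hwf]⟩

theorem isClosed_meeting (B : V →ₗ[ℝ] W →ₗ[ℝ] ℝ) {S : Set (ℙ ℝ V)} (hS : IsClosed S) :
    IsClosed (meeting B S) := by
  have := IsModuleTopology.toContinuousAdd ℝ V
  have := IsModuleTopology.toContinuousAdd ℝ W
  have := t2Space W
  obtain ⟨K, hK, h0K, hKex⟩ := exists_isCompact_forall_exists_smul_mem V
  rw [← isOpen_compl_iff, isOpen_iff_isOpen_cone] at hS ⊢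
  have hKS : IsCompact (K \ cone Sᶜ) := hK.diff hS
  have hBc : Continuous (fun x : V × W => B x.1 x.2) :=
    IsModuleTopology.continuous_bilinear_of_finite_left B
  -- Projecting the closed incidence relation along a compact factor gives a closed set.
  have hcl : IsClosed {f : W | ∃ v ∈ K \ cone Sᶜ, B v f = 0} := by
    have := isCompact_iff_compactSpace.1 hKS
    have hZ : IsClosed {x : ↥(K \ cone Sᶜ) × W | B x.1 x.2 = 0} :=
      isClosed_eq (hBc.comp (continuous_subtype_val.prodMap continuous_id)) continuous_const
    convert isClosedMap_snd_of_compactSpace _ hZ using 1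
    ext f
    simp
  have hset : cone (meeting B S)ᶜ = {0}ᶜ \ {f : W | ∃ v ∈ K \ cone Sᶜ, B v f = 0} := by
    have hcompl (f : W) : f ∈ cone (meeting B S)ᶜ ↔ f ≠ 0 ∧ f ∉ cone (meeting B S) :=
      ⟨fun ⟨h, h'⟩ => ⟨h, fun ⟨_, h''⟩ => h' h''⟩, fun ⟨h, h'⟩ => ⟨h, fun h'' => h' ⟨h, h''⟩⟩⟩
    ext f
    rw [hcompl, mem_cone_meeting]
    refine and_congr_right fun hf => not_congr ⟨?_, ?_⟩
    · rintro ⟨-, v, hv, hvf⟩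
      obtain ⟨a, ha, haK⟩ := hKex v hv.1
      exact ⟨a • v, ⟨haK, fun h => h.2 (smul_mem_cone hv ha).2⟩, by simp [hvf]⟩
    · rintro ⟨v, ⟨hvK, hvS⟩, hvf⟩
      have hv : v ≠ 0 := fun h => h0K (h ▸ hvK)
      exact ⟨hf, v, ⟨hv, by_contra fun h => hvS ⟨hv, h⟩⟩, hvf⟩
  rw [hset]
  exact isOpen_compl_singleton.sdiff hcl

end Pairing

/-! ### `Phi` and `PhiDual` in terms of incidence. -/

section Duality

variable {V : Type*} [AddCommGroup V] [Module ℝ V]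

theorem incident_iff {p : ℙ ℝ V} {q : ℙ ℝ (Module.Dual ℝ V)} :
    Incident p q ↔ q.rep p.rep = 0 := by
  rw [Incident, Projectivization.submodule_eq p, Projectivization.submodule_eq q]
  constructor
  · intro h
    exact h _ (Submodule.mem_span_singleton_self _) _ (Submodule.mem_span_singleton_self _)
  · intro h v hv f hf
    obtain ⟨a, rfl⟩ := Submodule.mem_span_singleton.1 hv
    obtain ⟨b, rfl⟩ := Submodule.mem_span_singleton.1 hf
    simp [h]

theorem deltaOfDual_eq (q : ℙ ℝ (Module.Dual ℝ V)) : deltaOfDual q = nonvanishing q.rep := by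
  ext p
  simp [deltaOfDual, incident_iff, nonvanishing, Projectivization.submodule_eq,
    Submodule.span_singleton_le_iff_mem]

theorem delta_eq (p : ℙ ℝ V) : delta p = nonvanishing (Module.Dual.eval ℝ V p.rep) := by
  ext q
  simp [delta, incident_iff, nonvanishing, Projectivization.submodule_eq,
    Submodule.span_singleton_le_iff_mem]

theorem separatingRight_eval : (Module.Dual.eval ℝ V).SeparatingRight := fun _ h =>
  LinearMap.ext h

variable [FiniteDimensional ℝ V]

theorem Phi_eq (S : Set (ℙ ℝ V)) : Phi S = (meeting (Module.Dual.eval ℝ V) S)ᶜ := by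
  ext q
  have hirr : IsIrreducibleConvex (deltaOfDual q) :=
    deltaOfDual_eq q ▸ isIrreducibleConvex_nonvanishing q.rep_nonzero
  have : q ∈ Phi S ↔ S ⊆ deltaOfDual q :=
    ⟨fun ⟨_, _, h, hC⟩ => hC ▸ h, fun h => ⟨_, hirr, h, rfl⟩⟩
  rw [this]
  simp [meeting, deltaOfDual, incident_iff, Set.subset_def]

theorem PhiDual_eq (T : Set (ℙ ℝ (Module.Dual ℝ V))) :
    PhiDual T = (meeting (LinearMap.id : Module.Dual ℝ V →ₗ[ℝ] V →ₗ[ℝ] ℝ) T)ᶜ := by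
  ext p
  have hne : Module.Dual.eval ℝ V p.rep ≠ 0 := fun h =>
    p.rep_nonzero ((Module.forall_dual_apply_eq_zero_iff ℝ _).1 fun f => LinearMap.congr_fun h f)
  have hirr : IsIrreducibleConvex (delta p) := delta_eq p ▸ isIrreducibleConvex_nonvanishing hne
  have : p ∈ PhiDual T ↔ T ⊆ delta p :=
    ⟨fun ⟨_, _, h, hC⟩ => hC ▸ h, fun h => ⟨_, hirr, h, rfl⟩⟩
  rw [this]
  simp [meeting, delta, incident_iff, Set.subset_def]

theorem separatingLeft_eval : (Module.Dual.eval ℝ V).SeparatingLeft := fun v h =>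
  (Module.forall_dual_apply_eq_zero_iff ℝ v).1 h

end Duality

end ProjConvex

theorem mainTheorem8 {V : Type*} [AddCommGroup V] [Module ℝ V] (n : ℕ)
    (hV : Module.finrank ℝ V = n + 1) :
    (∀ S : Set (ℙ ℝ V), S.Nonempty → ProjConvex.IsMultiConvex S →
      (IsOpen S → IsClosed (ProjConvex.Phi S) ∧ ProjConvex.IsMultiConvex (ProjConvex.Phi S)) ∧
      (IsClosed S → IsOpen (ProjConvex.Phi S) ∧ ProjConvex.IsMultiConvex (ProjConvex.Phi S))) ∧
    (∀ T : Set (ℙ ℝ (Module.Dual ℝ V)), T.Nonempty → ProjConvex.IsMultiConvex T →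
      (IsOpen T →
        IsClosed (ProjConvex.PhiDual T) ∧ ProjConvex.IsMultiConvex (ProjConvex.PhiDual T)) ∧
      (IsClosed T →
        IsOpen (ProjConvex.PhiDual T) ∧ ProjConvex.IsMultiConvex (ProjConvex.PhiDual T))) := by
  have : FiniteDimensional ℝ V := Module.finite_of_finrank_eq_succ hV
  let : TopologicalSpace V := moduleTopology ℝ V
  let : TopologicalSpace (Module.Dual ℝ V) := moduleTopology ℝ (Module.Dual ℝ V)
  have : IsModuleTopology ℝ V := ⟨rfl⟩
  have : IsModuleTopology ℝ (Module.Dual ℝ V) := ⟨rfl⟩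
  refine ⟨fun S hne _ => ?_, fun T hne _ => ?_⟩
  · rw [ProjConvex.Phi_eq]
    have hmc := ProjConvex.isMultiConvex_compl_meeting ProjConvex.separatingLeft_eval hne
    exact ⟨fun hS => ⟨(ProjConvex.isOpen_meeting ProjConvex.separatingRight_eval hS).isClosed_compl,
      hmc⟩, fun hS => ⟨(ProjConvex.isClosed_meeting _ hS).isOpen_compl, hmc⟩⟩
  · rw [ProjConvex.PhiDual_eq]
    have hmc := ProjConvex.isMultiConvex_compl_meeting
      (B := (LinearMap.id : Module.Dual ℝ V →ₗ[ℝ] V →ₗ[ℝ] ℝ))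
      -- Swapping the two arguments turns `Module.Dual.eval` into the identity pairing, so left and
      -- right separation trade places.
      ProjConvex.separatingRight_eval hne
    exact ⟨fun hT => ⟨(ProjConvex.isOpen_meeting
      ProjConvex.separatingLeft_eval hT).isClosed_compl, hmc⟩,
      fun hT => ⟨(ProjConvex.isClosed_meeting _ hT).isOpen_compl, hmc⟩⟩
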